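/- Let $Q$ and $P$ be the position and momentum operators on $L^2(\mathbb{R})$ (complex-valued functions), $(Q\psi)(q) = q\,\psi(q)$ and $(P\psi)(q) = -\mathrm{i}\,\psi'(q)$. For $\theta \in \mathbb{R}$ let $Q(\theta)$ be the self-adjoint operator on $L^2(\mathbb{R})$ that is the closure of $Q\cos\theta + P\sin\theta$ defined on the Schwartz functions, and let $\operatorname{sgn} Q(\theta)$ be the bounded operator obtained from it by the Borel functional calculus, where $\operatorname{sgn} x = 1$ for $x>0$, $\operatorname{sgn} x = -1$ for $x<0$ and $\operatorname{sgn} 0 = 0$. Let $s,t \in \mathbb{R}$ satisfy $s < \pi < t < s+\pi$. Then, in the operator norm, \[ \| \operatorname{sgn} Q(0) + \operatorname{sgn} Q(s) + \operatorname{sgn} Q(t) \| < 3 . \] -/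

import Mathlib

noncomputable section

open MeasureTheory SchwartzMap
open scoped FourierTransform ENNReal ContDiff

namespace PhaseSpace

/-! ### Bounded multiplication operators on `L²` -/

section Mul

variable {X : Type*} [MeasurableSpace X] {μ : Measure X}

/-- Multiplication by an essentially bounded function `g`, as a bounded operator on `L²(μ)`. -/
def mulLp (g : X → ℂ) (hg : MemLp g ∞ μ) : Lp ℂ 2 μ →L[ℂ] Lp ℂ 2 μ :=
  (ContinuousLinearMap.mul ℂ ℂ).holderL μ ∞ 2 2 (hg.toLp g)

theorem coeFn_mulLp (g : X → ℂ) (hg : MemLp g ∞ μ) (f : Lp ℂ 2 μ) :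
    mulLp g hg f =ᵐ[μ] fun x => g x * f x := by
  have h1 := (ContinuousLinearMap.mul ℂ ℂ).coeFn_holder (r := 2) (hg.toLp g) f
  have h2 := hg.coeFn_toLp
  filter_upwards [h1, h2] with x h1 h2
  simpa [mulLp, h2] using h1

theorem memLp_top {g : X → ℂ} (hg : Measurable g) {C : ℝ} (hC : ∀ x, ‖g x‖ ≤ C) :
    MemLp g ∞ μ :=
  memLp_top_of_bound hg.aestronglyMeasurable C (.of_forall hC)

/-- Multiplication by a measurable function of modulus one, as a unitary operator on `L²(μ)`. -/
def mulUnitary (g : X → ℂ) (hg : Measurable g) (h1 : ∀ x, ‖g x‖ = 1) :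
    Lp ℂ 2 μ ≃ₗᵢ[ℂ] Lp ℂ 2 μ where
  toLinearEquiv := LinearEquiv.ofLinearMap
    (mulLp g (memLp_top hg fun x => (h1 x).le)).toLinearMap
    (mulLp (fun x => (g x)⁻¹)
      (memLp_top hg.inv (C := 1) fun x => by simp [h1 x])).toLinearMap
    (by
      ext1 f
      apply Lp.ext
      refine (coeFn_mulLp _ _ _).trans ?_
      filter_upwards [coeFn_mulLp (fun x => (g x)⁻¹)
        (memLp_top hg.inv (C := 1) fun x => by simp [h1 x]) f] with x hx
      have : g x ≠ 0 := by
        rw [← norm_ne_zero_iff, h1 x]; exact one_ne_zero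
      simp [hx, this])
    (by
      ext1 f
      apply Lp.ext
      refine (coeFn_mulLp _ _ _).trans ?_
      filter_upwards [coeFn_mulLp g (memLp_top hg fun x => (h1 x).le) f] with x hx
      have : g x ≠ 0 := by
        rw [← norm_ne_zero_iff, h1 x]; exact one_ne_zero
      simp [hx, this])
  norm_map' f := by
    change ‖mulLp g (memLp_top hg fun x => (h1 x).le) f‖ = ‖f‖
    rw [Lp.norm_def, Lp.norm_def]
    congr 1
    apply eLpNorm_congr_norm_ae
    filter_upwards [coeFn_mulLp g (memLp_top hg fun x => (h1 x).le) f] with x hx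
    simp [hx, h1 x]

theorem coeFn_mulUnitary (g : X → ℂ) (hg : Measurable g) (h1 : ∀ x, ‖g x‖ = 1)
    (f : Lp ℂ 2 μ) : mulUnitary g hg h1 f =ᵐ[μ] fun x => g x * f x :=
  coeFn_mulLp g _ f

end Mul

/-! ### Borel functional calculus of an essentially self-adjoint operator -/

/-- A diagonalization, as in the multiplication form of the spectral theorem, of a densely defined
essentially self-adjoint operator `T` on `H`: a unitary `U : H → L²(X, μ)` and a real measurable
function `h` on `X` such that `U` carries the closure of `T` (that is, the operator whose graph is
the closure of the graph of `T`) exactly to the operator of multiplication by `h` on its maximal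
domain `{f ∈ L²(μ) | h f ∈ L²(μ)}`. -/
structure Diagonalization {H : Type*} [NormedAddCommGroup H] [InnerProductSpace ℂ H]
    (T : H →ₗ.[ℂ] H) where
  X : Type
  [ms : MeasurableSpace X]
  μ : Measure X
  U : H ≃ₗᵢ[ℂ] Lp ℂ 2 μ
  h : X → ℝ
  measurable_h : Measurable h
  mem_closure_graph_iff : ∀ x y : H,
    (x, y) ∈ closure (T.graph : Set (H × H)) ↔ U y =ᵐ[μ] fun a => (h a : ℂ) * U x a

/-- The operator `f(T) = U⁻¹ M_{f ∘ h} U`, for a bounded Borel function `f`. -/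
def Diagonalization.borel {H : Type*} [NormedAddCommGroup H] [InnerProductSpace ℂ H]
    {T : H →ₗ.[ℂ] H} (D : Diagonalization T) (f : ℝ → ℝ) (hf : Measurable f)
    {C : ℝ} (hC : ∀ x, |f x| ≤ C) : H →L[ℂ] H :=
  letI := D.ms
  (D.U.symm : Lp ℂ 2 D.μ →L[ℂ] H) ∘L
    mulLp (fun a => (f (D.h a) : ℂ))
      (memLp_top (Complex.measurable_ofReal.comp (hf.comp D.measurable_h)) (C := C)
        fun a => by simpa using hC (D.h a)) ∘L
    (D.U : H →L[ℂ] Lp ℂ 2 D.μ)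

theorem measurable_sign : Measurable Real.sign := by
  unfold Real.sign
  exact Measurable.ite measurableSet_Iio measurable_const
    (Measurable.ite measurableSet_Ioi measurable_const measurable_const)

theorem abs_sign_le_one (x : ℝ) : |Real.sign x| ≤ 1 := by
  rcases Real.sign_apply_eq x with h | h | h <;> simp [h]

/-- The bounded operator `sgn T`. -/
def Diagonalization.sgn {H : Type*} [NormedAddCommGroup H] [InnerProductSpace ℂ H]
    {T : H →ₗ.[ℂ] H} (D : Diagonalization T) : H →L[ℂ] H :=
  D.borel Real.sign measurable_sign abs_sign_le_one

/-! ### The operators `Q(θ) = Q cos θ + P sin θ` in the Schrödinger representation -/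

/-- The Hilbert space `L²(ℝ)` of complex-valued functions. -/
abbrev L2 : Type := Lp ℂ 2 (volume : Measure ℝ)

/-- `(Qψ)(q) = q ψ(q)` on Schwartz functions. -/
def positionS : 𝓢(ℝ, ℂ) →L[ℂ] 𝓢(ℝ, ℂ) := smulLeftCLM ℂ (fun q : ℝ => (q : ℂ))

theorem positionS_apply (ψ : 𝓢(ℝ, ℂ)) (q : ℝ) : positionS ψ q = q * ψ q := by
  rw [positionS, smulLeftCLM_apply_apply Function.Complex.hasTemperateGrowth_ofReal, smul_eq_mul]

/-- `(Pψ)(q) = -i ψ'(q)` on Schwartz functions. -/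
def momentumS : 𝓢(ℝ, ℂ) →L[ℂ] 𝓢(ℝ, ℂ) := (-Complex.I) • derivCLM ℂ ℂ

theorem momentumS_apply (ψ : 𝓢(ℝ, ℂ)) (q : ℝ) :
    momentumS ψ q = -Complex.I * deriv ψ q := by
  simp [momentumS, derivCLM_apply]

/-- `Q(θ) = Q cos θ + P sin θ` on Schwartz functions. -/
def quadS (θ : ℝ) : 𝓢(ℝ, ℂ) →L[ℂ] 𝓢(ℝ, ℂ) :=
  (Real.cos θ : ℂ) • positionS + (Real.sin θ : ℂ) • momentumS

theorem quadS_apply (θ : ℝ) (ψ : 𝓢(ℝ, ℂ)) (q : ℝ) :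
    quadS θ ψ q =
      (Real.cos θ : ℂ) * (q * ψ q) + (Real.sin θ : ℂ) * (-Complex.I * deriv ψ q) := by
  rw [← positionS_apply, ← momentumS_apply]
  simp [quadS]

/-- The inclusion of the Schwartz space into `L²(ℝ)`. -/
def incl : 𝓢(ℝ, ℂ) →ₗ[ℂ] L2 := (toLpCLM ℂ ℂ 2 (volume : Measure ℝ)).toLinearMap

theorem incl_injective : Function.Injective incl := injective_toLp 2 (volume : Measure ℝ)

theorem coeFn_incl (ψ : 𝓢(ℝ, ℂ)) : incl ψ =ᵐ[volume] ψ := coeFn_toLp ψ 2 volume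

theorem denseRange_incl : DenseRange incl :=
  denseRange_toLpCLM (F := ℂ) (μ := (volume : Measure ℝ)) (p := 2) ENNReal.ofNat_ne_top

/-- `Q(θ)` as an unbounded operator on `L²(ℝ)`, with the Schwartz functions as its domain, on which
it is essentially self-adjoint. -/
def Q (θ : ℝ) : L2 →ₗ.[ℂ] L2 where
  domain := LinearMap.range incl
  toFun := incl ∘ₗ (quadS θ).toLinearMap ∘ₗ
    (LinearEquiv.ofInjective incl incl_injective).symm.toLinearMap

theorem mem_graph_Q (θ : ℝ) (p : L2 × L2) :
    p ∈ (Q θ).graph ↔ ∃ ψ : 𝓢(ℝ, ℂ), p = (incl ψ, incl (quadS θ ψ)) := by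
  have key : ∀ ψ : 𝓢(ℝ, ℂ), ∀ hψ : incl ψ ∈ (Q θ).domain,
      (Q θ) ⟨incl ψ, hψ⟩ = incl (quadS θ ψ) := by
    intro ψ hψ
    have : (LinearEquiv.ofInjective incl incl_injective).symm ⟨incl ψ, hψ⟩ = ψ := by
      rw [LinearEquiv.symm_apply_eq]; rfl
    change incl (quadS θ ((LinearEquiv.ofInjective incl incl_injective).symm ⟨incl ψ, hψ⟩)) = _
    rw [this]
  rw [LinearPMap.mem_graph_iff']
  constructor
  · rintro ⟨⟨y, ψ, rfl⟩, h⟩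
    exact ⟨ψ, h.symm.trans (Prod.ext rfl (key ψ ⟨ψ, rfl⟩))⟩
  · rintro ⟨ψ, rfl⟩
    exact ⟨⟨incl ψ, ψ, rfl⟩, Prod.ext rfl (key ψ ⟨ψ, rfl⟩)⟩

/-! ### An explicit diagonalization of `Q(θ)` -/

/-- `q ↦ exp(i a q²)`. -/
def chirp (a q : ℝ) : ℂ := Complex.exp ((a * q ^ 2 : ℝ) * Complex.I)

theorem norm_chirp (a q : ℝ) : ‖chirp a q‖ = 1 := Complex.norm_exp_ofReal_mul_I _

theorem chirp_mul_neg (a q : ℝ) : chirp a q * chirp (-a) q = 1 := by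
  rw [chirp, chirp, ← Complex.exp_add]
  simp

theorem hasDerivAt_chirp (a q : ℝ) :
    HasDerivAt (chirp a) (2 * a * q * Complex.I * chirp a q) q := by
  have h1 : HasDerivAt (fun q : ℝ => a * q ^ 2) (a * (2 * q)) q := by
    simpa using (hasDerivAt_pow 2 q).const_mul a
  have h2 := (h1.ofReal_comp.mul_const Complex.I).cexp
  refine h2.congr_deriv ?_
  simp only [chirp]
  push_cast
  ring

theorem measurable_chirp (a : ℝ) : Measurable (chirp a) := by
  unfold chirp; fun_prop

theorem contDiff_chirp (a : ℝ) : ContDiff ℝ ∞ (chirp a) := by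
  have h : ContDiff ℝ ∞ (fun q : ℝ => (((a * q ^ 2 : ℝ) : ℂ) * Complex.I)) :=
    (Complex.ofRealCLM.contDiff.comp (contDiff_const.mul (contDiff_id.pow 2))).mul contDiff_const
  exact Complex.contDiff_exp.comp h

theorem iteratedDeriv_chirp (a : ℝ) (n : ℕ) :
    ∃ p : Polynomial ℂ, iteratedDeriv n (chirp a) = fun q : ℝ => p.eval (q : ℂ) * chirp a q := by
  induction n with
  | zero => exact ⟨1, by simp⟩
  | succ n ih =>
    obtain ⟨p, hp⟩ := ih
    refine ⟨p.derivative + Polynomial.C (2 * a * Complex.I) * Polynomial.X * p, ?_⟩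
    funext q
    rw [iteratedDeriv_succ, hp]
    have h1 : HasDerivAt (fun q : ℝ => p.eval (q : ℂ)) (p.derivative.eval (q : ℂ)) q :=
      (p.hasDerivAt (q : ℂ)).comp_ofReal
    rw [(h1.fun_mul (hasDerivAt_chirp a q)).deriv]
    simp only [Polynomial.eval_add, Polynomial.eval_mul, Polynomial.eval_C, Polynomial.eval_X]
    ring

theorem poly_bound (p : Polynomial ℂ) :
    ∃ (k : ℕ) (C : ℝ), ∀ q : ℝ, ‖p.eval (q : ℂ)‖ ≤ C * (1 + ‖q‖) ^ k := by
  refine ⟨p.natDegree, ∑ i ∈ Finset.range (p.natDegree + 1), ‖p.coeff i‖, fun q => ?_⟩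
  rw [Polynomial.eval_eq_sum_range, Finset.sum_mul]
  refine (norm_sum_le _ _).trans (Finset.sum_le_sum fun i hi => ?_)
  rw [norm_mul, norm_pow, Complex.norm_real]
  have h0 : 0 ≤ ‖q‖ := norm_nonneg q
  have hi' : i ≤ p.natDegree := Nat.lt_succ_iff.mp (Finset.mem_range.mp hi)
  gcongr
  calc ‖q‖ ^ i ≤ (1 + ‖q‖) ^ i := by gcongr; linarith
    _ ≤ (1 + ‖q‖) ^ p.natDegree := by gcongr; linarith

theorem hasTemperateGrowth_chirp (a : ℝ) : (chirp a).HasTemperateGrowth := by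
  refine ⟨contDiff_chirp a, fun n => ?_⟩
  obtain ⟨p, hp⟩ := iteratedDeriv_chirp a n
  obtain ⟨k, C, h⟩ := poly_bound p
  refine ⟨k, C, fun q => ?_⟩
  rw [norm_iteratedFDeriv_eq_norm_iteratedDeriv, hp]
  simpa [norm_chirp] using h q

/-- Multiplication by the chirp on Schwartz functions. -/
def chirpS (a : ℝ) : 𝓢(ℝ, ℂ) →L[ℂ] 𝓢(ℝ, ℂ) := smulLeftCLM ℂ (chirp a)

theorem chirpS_apply (a : ℝ) (ψ : 𝓢(ℝ, ℂ)) (q : ℝ) : chirpS a ψ q = chirp a q * ψ q := by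
  rw [chirpS, smulLeftCLM_apply_apply (hasTemperateGrowth_chirp a), smul_eq_mul]

/-- The chirp intertwines `Q(θ)` and `P sin θ`. -/
theorem chirpS_quadS {θ : ℝ} (hθ : Real.sin θ ≠ 0) (ψ : 𝓢(ℝ, ℂ)) :
    chirpS (Real.cos θ / (2 * Real.sin θ)) (quadS θ ψ) =
      (Real.sin θ : ℂ) • momentumS (chirpS (Real.cos θ / (2 * Real.sin θ)) ψ) := by
  set a := Real.cos θ / (2 * Real.sin θ) with ha
  have hc : (Real.cos θ : ℂ) = 2 * a * Real.sin θ := by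
    rw [ha]
    have : (Real.sin θ : ℂ) ≠ 0 := by exact_mod_cast hθ
    push_cast
    push_cast at this
    field_simp
  ext q
  have hd : deriv (chirpS a ψ) q =
      2 * a * q * Complex.I * chirp a q * ψ q + chirp a q * deriv ψ q := by
    have h : (chirpS a ψ : ℝ → ℂ) = fun q => chirp a q * ψ q := funext (chirpS_apply a ψ)
    rw [h]
    exact ((hasDerivAt_chirp a q).fun_mul (ψ.hasDerivAt q)).deriv
  rw [chirpS_apply, quadS_apply, smul_apply, momentumS_apply, hd, hc, smul_eq_mul]
  linear_combination (2 * a * Real.sin θ * q * chirp a q * ψ q) * Complex.I_sq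

theorem fourier_momentumS (ψ : 𝓢(ℝ, ℂ)) :
    𝓕 (momentumS ψ) = ((2 * Real.pi : ℝ) : ℂ) • positionS (𝓕 ψ) := by
  have h : momentumS ψ = (-Complex.I) • derivCLM ℂ ℂ ψ := rfl
  have h2 : ∀ ξ : ℝ, 𝓕 (derivCLM ℂ ℂ ψ) ξ = (2 * Real.pi * Complex.I * ξ) * 𝓕 ψ ξ := by
    intro ξ
    have h3 := Real.fourier_deriv (f := (ψ : ℝ → ℂ)) ψ.integrable ψ.differentiable
      (derivCLM ℂ ℂ ψ).integrable
    have h4 := congrFun h3 ξ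
    have h5 : (derivCLM ℂ ℂ ψ : ℝ → ℂ) = deriv ψ := funext (derivCLM_apply ℂ ψ)
    rw [fourier_coe, fourier_coe, h5, h4, smul_eq_mul]
  ext ξ
  rw [h, FourierTransform.fourier_smul, smul_apply, smul_apply, h2, positionS_apply]
  simp only [smul_eq_mul]
  push_cast
  linear_combination (-2 * Real.pi * ξ * 𝓕 ψ ξ) * Complex.I_sq

/-- The diagonalizing unitary: the identity if `sin θ = 0`, otherwise a chirp followed by the
Fourier transform. -/
def diagU (θ : ℝ) : L2 ≃ₗᵢ[ℂ] L2 :=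
  if Real.sin θ = 0 then LinearIsometryEquiv.refl ℂ L2
  else (mulUnitary (chirp (Real.cos θ / (2 * Real.sin θ))) (measurable_chirp _)
    (norm_chirp _)).trans (Lp.fourierTransformₗᵢ ℝ ℂ)

/-- `diagU θ` carries `Q(θ)` to multiplication by `x ↦ diagScale θ * x`. -/
def diagScale (θ : ℝ) : ℝ :=
  if Real.sin θ = 0 then Real.cos θ else 2 * Real.pi * Real.sin θ

theorem exists_diagS (θ : ℝ) : ∃ V : 𝓢(ℝ, ℂ) → 𝓢(ℝ, ℂ), Function.Surjective V ∧
    (∀ ψ, diagU θ (incl ψ) = incl (V ψ)) ∧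
    ∀ ψ, V (quadS θ ψ) = (diagScale θ : ℂ) • positionS (V ψ) := by
  by_cases hθ : Real.sin θ = 0
  · refine ⟨id, Function.surjective_id, fun ψ => by simp [diagU, hθ], fun ψ => ?_⟩
    simp [diagScale, hθ, quadS]
  · set a := Real.cos θ / (2 * Real.sin θ) with ha
    refine ⟨fun ψ => 𝓕 (chirpS a ψ), fun φ => ⟨chirpS (-a) (𝓕⁻ φ), ?_⟩, fun ψ => ?_, fun ψ => ?_⟩
    · have : chirpS a (chirpS (-a) (𝓕⁻ φ)) = 𝓕⁻ φ := by
        ext q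
        rw [chirpS_apply, chirpS_apply, ← mul_assoc, chirp_mul_neg, one_mul]
      simp [this]
    · have h : mulUnitary (chirp a) (measurable_chirp a) (norm_chirp a) (incl ψ) =
          incl (chirpS a ψ) := by
        apply Lp.ext
        filter_upwards [coeFn_mulUnitary (chirp a) (measurable_chirp a) (norm_chirp a) (incl ψ),
          coeFn_incl ψ, coeFn_incl (chirpS a ψ)] with q h1 h2 h3
        rw [h1, h2, h3, chirpS_apply]
      simp only [diagU, hθ, if_false, LinearIsometryEquiv.trans_apply, ← ha, h]
      exact toLp_fourier_eq (chirpS a ψ)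
    · simp only [ha, chirpS_quadS hθ, FourierTransform.fourier_smul, fourier_momentumS, diagScale,
        hθ, if_false, smul_smul]
      congr 1
      push_cast
      ring

theorem den_ne_zero (c x : ℝ) : ((c * x : ℝ) : ℂ) + Complex.I ≠ 0 := by
  intro h
  simpa using congrArg Complex.im h

theorem one_le_norm_den (c x : ℝ) : 1 ≤ ‖((c * x : ℝ) : ℂ) + Complex.I‖ := by
  simpa using Complex.abs_im_le_norm (((c * x : ℝ) : ℂ) + Complex.I)

theorem abs_le_norm_den (c x : ℝ) : |c * x| ≤ ‖((c * x : ℝ) : ℂ) + Complex.I‖ := by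
  simpa using Complex.abs_re_le_norm (((c * x : ℝ) : ℂ) + Complex.I)

theorem hasTemperateGrowth_res (c : ℝ) :
    (fun x : ℝ => (((c * x : ℝ) : ℂ) + Complex.I)⁻¹).HasTemperateGrowth := by
  have h1 : (fun x : ℝ => c * x).HasTemperateGrowth := by fun_prop
  have h2 := (Function.hasTemperateGrowth_one_add_norm_sq_rpow ℝ (-1)).comp h1
  have h3 := Function.Complex.hasTemperateGrowth_ofReal.comp h2
  have h4 := (Function.Complex.hasTemperateGrowth_ofReal.comp h1).sub
    (Function.HasTemperateGrowth.const Complex.I)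
  suffices hfun : (fun x : ℝ => (((c * x : ℝ) : ℂ) + Complex.I)⁻¹) =
      fun x : ℝ => (((1 + ‖c * x‖ ^ 2) ^ (-1 : ℝ) : ℝ) : ℂ) * (((c * x : ℝ) : ℂ) - Complex.I) by
    rw [hfun]; exact h3.mul h4
  funext x
  have e : (((1 + ‖c * x‖ ^ 2) ^ (-1 : ℝ) : ℝ) : ℂ) =
      (((c * x : ℝ) : ℂ) + Complex.I)⁻¹ * (((c * x : ℝ) : ℂ) - Complex.I)⁻¹ := by
    rw [Real.rpow_neg_one, Real.norm_eq_abs, sq_abs, ← mul_inv]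
    push_cast
    congr 1
    linear_combination Complex.I_sq
  have hne : ((c * x : ℝ) : ℂ) - Complex.I ≠ 0 := by
    intro h
    simpa using congrArg Complex.im h
  rw [e, mul_assoc, inv_mul_cancel₀ hne, mul_one]

theorem memLp_res (c : ℝ) :
    MemLp (fun x : ℝ => (((c * x : ℝ) : ℂ) + Complex.I)⁻¹) ∞ (volume : Measure ℝ) :=
  memLp_top (by fun_prop) (C := 1) fun x => by
    rw [norm_inv]; exact inv_le_one_of_one_le₀ (one_le_norm_den c x)

theorem memLp_mulRes (c : ℝ) :
    MemLp (fun x : ℝ => ((c * x : ℝ) : ℂ) * (((c * x : ℝ) : ℂ) + Complex.I)⁻¹) ∞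
      (volume : Measure ℝ) :=
  memLp_top (by fun_prop) (C := 1) fun x => by
    rw [norm_mul, norm_inv, ← div_eq_mul_inv, Complex.norm_real, Real.norm_eq_abs]
    exact div_le_one_of_le₀ (abs_le_norm_den c x) (norm_nonneg _)

/-- The closure of `Q(θ)` is unitarily equivalent to a real multiplication operator. -/
theorem mem_closure_graph_Q (θ : ℝ) (x y : L2) :
    (x, y) ∈ closure ((Q θ).graph : Set (L2 × L2)) ↔
      diagU θ y =ᵐ[volume] fun a => ((diagScale θ * a : ℝ) : ℂ) * diagU θ x a := by
  obtain ⟨V, hV, hUV, hVQ⟩ := exists_diagS θ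
  set c := diagScale θ
  set U := diagU θ
  set R := mulLp _ (memLp_res c) with hR
  set M := mulLp _ (memLp_mulRes c) with hM
  constructor
  · have hcl : IsClosed {p : L2 × L2 | R (U p.2) = M (U p.1)} :=
      isClosed_eq (R.continuous.comp (U.continuous.comp continuous_snd))
        (M.continuous.comp (U.continuous.comp continuous_fst))
    have hsub : ((Q θ).graph : Set (L2 × L2)) ⊆ {p | R (U p.2) = M (U p.1)} := by
      intro p hp
      obtain ⟨ψ, rfl⟩ := (mem_graph_Q θ p).1 hp
      change R (U (incl (quadS θ ψ))) = M (U (incl ψ))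
      rw [hUV, hUV, hVQ]
      apply Lp.ext
      filter_upwards [coeFn_mulLp _ (memLp_res c) (incl ((c : ℂ) • positionS (V ψ))),
        coeFn_mulLp _ (memLp_mulRes c) (incl (V ψ)), coeFn_incl (V ψ),
        coeFn_incl ((c : ℂ) • positionS (V ψ))] with a h1 h2 h3 h4
      rw [h1, h2, h3, h4, smul_apply, positionS_apply, smul_eq_mul]
      push_cast
      ring
    intro h
    have h' : R (U y) = M (U x) := closure_minimal hsub hcl h
    have e1 := coeFn_mulLp _ (memLp_res c) (U y)
    have e2 := coeFn_mulLp _ (memLp_mulRes c) (U x)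
    rw [← hR, h'] at e1
    rw [← hM] at e2
    filter_upwards [e1, e2] with a h1 h2
    have h3 := h1.symm.trans h2
    have hd := den_ne_zero c a
    field_simp at h3
    linear_combination h3
  · intro h
    have hk : ∀ k : L2, (U.symm (R k), U.symm (M k)) ∈ closure ((Q θ).graph : Set (L2 × L2)) := by
      intro k
      have hcl : IsClosed {k : L2 | (U.symm (R k), U.symm (M k)) ∈
          closure ((Q θ).graph : Set (L2 × L2))} :=
        isClosed_closure.preimage ((U.symm.continuous.comp R.continuous).prodMk
          (U.symm.continuous.comp M.continuous))
      refine denseRange_incl.induction_on k hcl fun φ => subset_closure ?_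
      obtain ⟨ψ, hψ⟩ := hV (smulLeftCLM ℂ (fun x : ℝ => (((c * x : ℝ) : ℂ) + Complex.I)⁻¹) φ)
      have hψa : ∀ a, V ψ a = (((c * a : ℝ) : ℂ) + Complex.I)⁻¹ * φ a := fun a => by
        rw [hψ, smulLeftCLM_apply_apply (hasTemperateGrowth_res c), smul_eq_mul]
      refine (mem_graph_Q θ _).2 ⟨ψ, ?_⟩
      refine Prod.ext ?_ ?_
      · change U.symm (R (incl φ)) = incl ψ
        rw [LinearIsometryEquiv.symm_apply_eq, hUV]
        apply Lp.ext
        filter_upwards [coeFn_mulLp _ (memLp_res c) (incl φ), coeFn_incl φ,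
          coeFn_incl (V ψ)] with a h1 h2 h3
        rw [h1, h2, h3, hψa]
      · change U.symm (M (incl φ)) = incl (quadS θ ψ)
        rw [LinearIsometryEquiv.symm_apply_eq, hUV, hVQ]
        apply Lp.ext
        filter_upwards [coeFn_mulLp _ (memLp_mulRes c) (incl φ), coeFn_incl φ,
          coeFn_incl ((c : ℂ) • positionS (V ψ))] with a h1 h2 h3
        rw [h1, h2, h3, smul_apply, positionS_apply, hψa, smul_eq_mul]
        push_cast
        ring
    have hx : U.symm (R (U y + Complex.I • U x)) = x := by
      rw [LinearIsometryEquiv.symm_apply_eq]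
      apply Lp.ext
      filter_upwards [coeFn_mulLp _ (memLp_res c) (U y + Complex.I • U x),
        Lp.coeFn_add (U y) (Complex.I • U x), Lp.coeFn_smul Complex.I (U x), h] with a h1 h2 h3 h4
      have hd := den_ne_zero c a
      rw [h1, h2, Pi.add_apply, h3, Pi.smul_apply, h4, smul_eq_mul, ← add_mul, ← mul_assoc,
        inv_mul_cancel₀ hd, one_mul]
    have hy : U.symm (M (U y + Complex.I • U x)) = y := by
      rw [LinearIsometryEquiv.symm_apply_eq]
      apply Lp.ext
      filter_upwards [coeFn_mulLp _ (memLp_mulRes c) (U y + Complex.I • U x),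
        Lp.coeFn_add (U y) (Complex.I • U x), Lp.coeFn_smul Complex.I (U x), h] with a h1 h2 h3 h4
      have hd := den_ne_zero c a
      rw [h1, h2, Pi.add_apply, h3, Pi.smul_apply, h4, smul_eq_mul, ← add_mul, mul_assoc,
        ← mul_assoc _ _ (U x a), inv_mul_cancel₀ hd, one_mul]
    have := hk (U y + Complex.I • U x)
    rwa [hx, hy] at this

/-- The diagonalization of `Q(θ)` by `diagU θ`. -/
def diagQ (θ : ℝ) : Diagonalization (Q θ) where
  X := ℝ
  μ := volume
  U := diagU θ
  h := fun a => diagScale θ * a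
  measurable_h := by fun_prop
  mem_closure_graph_iff := mem_closure_graph_Q θ

/-- The bounded self-adjoint operator `sgn Q(θ)` on `L²(ℝ)`, by the Borel functional calculus. -/
def sgnQ (θ : ℝ) : L2 →L[ℂ] L2 := (diagQ θ).sgn

end PhaseSpace

end

/-! The directions `0`, `s`, `t` are positively dependent: there are weights `w i > 0` for which the
sum of `w i * Q(θ i)` vanishes. Classically, three numbers with zero sum cannot all be positive, nor
all negative. The quantum observables have no joint distribution to which this could be applied, but
they acquire one after adding noise: for an even window `g`, the squared modulus of the short-time
Fourier transform of a unit vector `f` is a genuine probability density on phase space, and its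
marginal in each direction `θ` is the law of `Q(θ)` in the state `f` convolved with a centred law of
finite variance that depends only on `g` and `θ` (`map_phaseMeasure`).

Suppose the three signals were positive with probability near one. The noisy variables have zero
sum, so their suitably truncated means have nonpositive sum, while the noise lowers each truncated
mean by at most its second moment over `2 * L`, where `L` is the truncation level. For `L` large
this forces all three signals to be small with sizeable probability (`sum_measureReal_le`). But `Q(θ
0)` and `Q(θ 1)` are conjugate up to a chirp and scaling, so the uncertainty principle
`measureReal_fourier_add_le` forbids both from concentrating near zero. Hence the three
probabilities of a wrong sign have a sum of at least some `δ > 0` that does not depend on `f`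
(`exists_le_sum_measureReal`).

Applied to both signs `σ`, this bounds the quadratic form of the sum of the three operators by `3 -
δ` in absolute value on unit Schwartz functions. Since the sum is symmetric and Schwartz functions
are dense, its norm is below three. -/

noncomputable section

open MeasureTheory SchwartzMap
open scoped FourierTransform ENNReal ContDiff

namespace PhaseSpace

/-! ### Three random variables with zero sum and symmetric noise -/

/-- The truncation of `x` to the interval `[-2L, L]`. -/
def clamp (L x : ℝ) : ℝ := max (-(2 * L)) (min x L)

theorem measurable_clamp (L : ℝ) : Measurable (clamp L) := by
  unfold clamp; fun_prop

theorem abs_clamp_le {L : ℝ} (hL : 0 < L) (x : ℝ) : |clamp L x| ≤ 2 * L := by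
  rw [abs_le, clamp]
  exact ⟨le_max_left _ _, max_le (by linarith) ((min_le_right _ _).trans (by linarith))⟩

/-- The asymmetric window `[-2L, L]` is chosen for this. If one term is cut off at `-2L`, the other
two, at most `L` each, cannot outweigh it; if none is, truncation only decreases each term. -/
theorem clamp_add_clamp_add_clamp_nonpos {L a b c : ℝ} (hL : 0 < L) (h : a + b + c = 0) :
    clamp L a + clamp L b + clamp L c ≤ 0 := by
  unfold clamp
  rcases max_cases (-(2 * L)) (min a L) with h1 | h1 <;>
  rcases max_cases (-(2 * L)) (min b L) with h2 | h2 <;>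
  rcases max_cases (-(2 * L)) (min c L) with h3 | h3 <;>
  linarith [min_le_left a L, min_le_left b L, min_le_left c L, min_le_right a L,
    min_le_right b L, min_le_right c L]

/-- A lower bound that separates the signal `u` from the noise `v`. The concave parabola `v - v ^ 2
/ (2 * L)` lies below `v` and never exceeds `L / 2`, which leaves room for `τ ≤ L / 2` under the cap
`L`; the penalty `3 * L` for `u ≤ 0` pushes the left side below `-2L`. -/
theorem le_clamp_add {L τ u v : ℝ} (hL : 0 < L) (hτ : 0 < τ) (hτL : 2 * τ ≤ L) :
    (Set.Ioi τ).indicator (fun _ => τ) u - (Set.Iic 0).indicator (fun _ => 3 * L) u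
      + (v - v ^ 2 / (2 * L)) ≤ clamp L (u + v) := by
  have hv : v ^ 2 / (2 * L) * (2 * L) = v ^ 2 := by field_simp
  set w := v ^ 2 / (2 * L) with hw
  have hw0 : 0 ≤ w := by positivity
  have hvw : v - w ≤ L / 2 := by nlinarith [sq_nonneg (v - L)]
  rcases le_or_gt u 0 with hu | hu
  · rw [Set.indicator_of_notMem (by simp; linarith), Set.indicator_of_mem (by simpa using hu)]
    refine le_trans ?_ (le_max_left _ _)
    linarith
  · rw [Set.indicator_of_notMem (s := Set.Iic 0) (by simpa using hu), sub_zero]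
    refine le_trans ?_ (le_max_right _ _)
    by_cases h : τ < u
    · rw [Set.indicator_of_mem (by simpa using h)]
      exact le_min (by linarith) (by linarith)
    · rw [Set.indicator_of_notMem (by simpa using h)]
      exact le_min (by linarith) (by linarith)

/-- If `Y` is centred with finite second moment and independent of `X`, then adding it to `X` costs
little in the truncated mean. -/
theorem le_integral_clamp {μ γ : Measure ℝ} [IsProbabilityMeasure μ] [IsProbabilityMeasure γ]
    {κ L τ : ℝ} (hL : 0 < L) (hτ : 0 < τ) (hτL : 2 * τ ≤ L)
    (h1 : Integrable (fun y => y) γ) (h2 : Integrable (fun y => y ^ 2) γ)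
    (h0 : ∫ y, y ∂γ = 0) :
    τ * μ.real {x | τ < κ * x} - 3 * L * μ.real {x | κ * x ≤ 0}
      - κ ^ 2 * (∫ y, y ^ 2 ∂γ) / (2 * L) ≤
      ∫ z : ℝ, clamp L z ∂((μ.prod γ).map fun z => κ * (z.1 + z.2)) := by
  have hA : MeasurableSet {x : ℝ | τ < κ * x} := measurableSet_lt (by fun_prop) (by fun_prop)
  have hB : MeasurableSet {x : ℝ | κ * x ≤ 0} := measurableSet_le (by fun_prop) (by fun_prop)
  rw [integral_map (by fun_prop) (measurable_clamp L).aestronglyMeasurable]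
  -- The minorant is `p` of the signal plus `r` of the noise, so its integral over the product
  -- measure splits. The linear part of `r` drops out because the noise is centred.
  set p : ℝ → ℝ := fun x => {x | τ < κ * x}.indicator (fun _ => τ) x -
    {x | κ * x ≤ 0}.indicator (fun _ => 3 * L) x with hp
  set r : ℝ → ℝ := fun y => κ * y - κ ^ 2 / (2 * L) * y ^ 2 with hr
  have ip1 : Integrable ({x | τ < κ * x}.indicator (fun _ => τ)) μ :=
    (integrable_const τ).indicator hA
  have ip2 : Integrable ({x | κ * x ≤ 0}.indicator (fun _ => 3 * L)) μ :=
    (integrable_const (3 * L)).indicator hB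
  have ip : Integrable p μ := ip1.sub ip2
  have ir : Integrable r γ := (h1.const_mul κ).sub (h2.const_mul _)
  have ep : ∫ x, p x ∂μ = τ * μ.real {x | τ < κ * x} - 3 * L * μ.real {x | κ * x ≤ 0} := by
    rw [hp, integral_sub ip1 ip2, integral_indicator_const _ hA, integral_indicator_const _ hB]
    simp only [smul_eq_mul]
    ring
  have er : ∫ y, r y ∂γ = - (κ ^ 2 * (∫ y, y ^ 2 ∂γ) / (2 * L)) := by
    rw [hr, integral_sub (h1.const_mul κ) (h2.const_mul _), integral_const_mul,
      integral_const_mul, h0]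
    ring
  have e : ∫ z, p z.1 + r z.2 ∂(μ.prod γ) = ∫ x, p x ∂μ + ∫ y, r y ∂γ := by
    rw [integral_add (ip.comp_fst γ) (ir.comp_snd μ), integral_fun_fst, integral_fun_snd]
    simp
  rw [sub_eq_add_neg, ← er, ← ep, ← e]
  refine integral_mono ((ip.comp_fst γ).add (ir.comp_snd μ)) ?_ fun z => ?_
  · refine Integrable.of_bound ((measurable_clamp L).comp (by fun_prop)).aestronglyMeasurable
      (2 * L) (.of_forall fun z => ?_)
    exact abs_clamp_le hL _
  · have := le_clamp_add (u := κ * z.1) (v := κ * z.2) hL hτ hτL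
    simp only [mul_add]
    refine le_trans (le_of_eq ?_) this
    simp only [hp, hr, Set.indicator_apply, Set.mem_ofPred_eq, Set.mem_Ioi, Set.mem_Iic]
    ring

/-- Three random variables with zero sum, each of them the sum of a signal `κ i * x` and an
independent centred noise, cannot all have an almost surely positive signal unless the signals are
small. -/
theorem sum_measureReal_le {Ω : Type*} [MeasurableSpace Ω] {m : Measure Ω}
    [IsProbabilityMeasure m] {X : Fin 3 → Ω → ℝ} (hX : ∀ i, Measurable (X i))
    (hsum : ∀ z, X 0 z + X 1 z + X 2 z = 0)
    {μ γ : Fin 3 → Measure ℝ} [∀ i, IsProbabilityMeasure (μ i)]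
    [∀ i, IsProbabilityMeasure (γ i)] {κ : Fin 3 → ℝ}
    (hlaw : ∀ i, m.map (X i) = ((μ i).prod (γ i)).map fun z => κ i * (z.1 + z.2))
    (h1 : ∀ i, Integrable (fun y => y) (γ i)) (h2 : ∀ i, Integrable (fun y => y ^ 2) (γ i))
    (h0 : ∀ i, ∫ y, y ∂(γ i) = 0) {L τ : ℝ} (hL : 0 < L) (hτ : 0 < τ) (hτL : 2 * τ ≤ L) :
    τ * ∑ i, (μ i).real {x | τ < κ i * x} ≤ 3 * L * ∑ i, (μ i).real {x | κ i * x ≤ 0}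
      + (∑ i, κ i ^ 2 * ∫ y, y ^ 2 ∂(γ i)) / (2 * L) := by
  have key := fun i => le_integral_clamp (μ := μ i) (κ := κ i) hL hτ hτL (h1 i) (h2 i) (h0 i)
  have hi : ∀ i, Integrable (fun z => clamp L (X i z)) m := fun i =>
    Integrable.of_bound ((measurable_clamp L).comp (hX i)).aestronglyMeasurable
      (2 * L) (.of_forall fun z => abs_clamp_le hL _)
  have e : ∀ i, ∫ z : ℝ, clamp L z ∂(((μ i).prod (γ i)).map fun z => κ i * (z.1 + z.2)) =
      ∫ z, clamp L (X i z) ∂m := fun i => by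
    rw [← hlaw, integral_map (hX i).aemeasurable (measurable_clamp L).aestronglyMeasurable]
  have hle : ∫ z, clamp L (X 0 z) ∂m + ∫ z, clamp L (X 1 z) ∂m + ∫ z, clamp L (X 2 z) ∂m ≤ 0 := by
    have h01 : Integrable (fun z => clamp L (X 0 z) + clamp L (X 1 z)) m := (hi 0).add (hi 1)
    rw [← integral_add (hi 0) (hi 1), ← integral_add h01 (hi 2)]
    exact integral_nonpos fun z => clamp_add_clamp_add_clamp_nonpos hL (hsum z)
  simp only [e] at key
  have k0 := key 0
  have k1 := key 1
  have k2 := key 2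
  simp only [Fin.sum_univ_three, mul_add, add_div]
  linarith

/-! ### The short-time Fourier transform -/

/-- The Schwartz function `x ↦ f x * g (x - q)`. -/
def windowed (f g : 𝓢(ℝ, ℂ)) (q : ℝ) : 𝓢(ℝ, ℂ) :=
  pairing (ContinuousLinearMap.mul ℂ ℂ) f (compSubConstCLM ℂ q g)

theorem windowed_apply (f g : 𝓢(ℝ, ℂ)) (q x : ℝ) : windowed f g q x = f x * g (x - q) := by
  simp [windowed]

/-- The short-time Fourier transform of `f` with window `g`. -/
def stft (f g : 𝓢(ℝ, ℂ)) (q ξ : ℝ) : ℂ := 𝓕 (windowed f g q) ξ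

theorem fourierS_apply (f : 𝓢(ℝ, ℂ)) (ξ : ℝ) :
    𝓕 f ξ = ∫ x : ℝ, Complex.exp ((-2 * Real.pi * x * ξ : ℝ) * Complex.I) * f x := by
  rw [fourier_coe, Real.fourier_real_eq_integral_exp_smul]
  simp

theorem stft_apply (f g : 𝓢(ℝ, ℂ)) (q ξ : ℝ) :
    stft f g q ξ =
      ∫ x : ℝ, Complex.exp ((-2 * Real.pi * x * ξ : ℝ) * Complex.I) * (f x * g (x - q)) := by
  simp [stft, fourierS_apply, windowed_apply]

theorem measurable_stft (f g : 𝓢(ℝ, ℂ)) : Measurable fun z : ℝ × ℝ => stft f g z.1 z.2 := by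
  simp only [stft_apply]
  have hc : Continuous fun w : (ℝ × ℝ) × ℝ =>
      Complex.exp ((-2 * Real.pi * w.2 * w.1.2 : ℝ) * Complex.I) *
        (f w.2 * g (w.2 - w.1.1)) := by
    have := f.continuous
    have := g.continuous
    fun_prop
  exact (StronglyMeasurable.integral_prod_right hc.stronglyMeasurable).measurable

theorem integrable_norm_sq (f : 𝓢(ℝ, ℂ)) : Integrable fun x => ‖f x‖ ^ 2 := by
  simpa using (f.memLp 2 volume).integrable_norm_pow (by norm_num)

theorem lintegral_enorm_sq (f : 𝓢(ℝ, ℂ)) :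
    ∫⁻ x, ‖f x‖ₑ ^ 2 = ENNReal.ofReal (∫ x, ‖f x‖ ^ 2) := by
  rw [ofReal_integral_eq_lintegral_ofReal (integrable_norm_sq f) (.of_forall fun x => by positivity)]
  refine lintegral_congr fun x => ?_
  rw [ENNReal.ofReal_pow (norm_nonneg _), ofReal_norm]

/-- Plancherel's theorem in terms of the lower Lebesgue integral. -/
theorem lintegral_enorm_sq_fourier (f : 𝓢(ℝ, ℂ)) :
    ∫⁻ ξ, ‖𝓕 f ξ‖ₑ ^ 2 = ∫⁻ x, ‖f x‖ₑ ^ 2 := by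
  rw [lintegral_enorm_sq, lintegral_enorm_sq, integral_norm_sq_fourier]

theorem lintegral_enorm_sq_stft (f g : 𝓢(ℝ, ℂ)) (q : ℝ) :
    ∫⁻ ξ, ‖stft f g q ξ‖ₑ ^ 2 = ∫⁻ x, ‖f x‖ₑ ^ 2 * ‖g (x - q)‖ₑ ^ 2 := by
  simp only [stft, lintegral_enorm_sq_fourier, windowed_apply, enorm_mul, mul_pow]

theorem fourierS_even {g : 𝓢(ℝ, ℂ)} (hg : ∀ x, g (-x) = g x) (ξ : ℝ) : 𝓕 g (-ξ) = 𝓕 g ξ := by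
  rw [fourierS_apply, fourierS_apply, ← integral_neg_eq_self]
  refine integral_congr_ae (.of_forall fun x => ?_)
  simp only [hg]
  congr 3
  push_cast
  ring

theorem fourierS_apply_neg (f : 𝓢(ℝ, ℂ)) (η : ℝ) : 𝓕⁻ f (-η) = 𝓕 f η := by
  rw [fourierInv_coe, fourier_coe, Real.fourierInv_eq_fourier_neg, neg_neg]

/-- Up to a phase, the short-time Fourier transform of the Fourier transforms is the rotated
short-time Fourier transform. -/
theorem norm_stft_fourier (f : 𝓢(ℝ, ℂ)) {g : 𝓢(ℝ, ℂ)} (hg : ∀ x, g (-x) = g x) (q ξ : ℝ) :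
    ‖stft (𝓕 f) (𝓕 g) ξ (-q)‖ = ‖stft f g q ξ‖ := by
  set k : ℝ → ℂ := fun x =>
    Complex.exp ((-2 * Real.pi * x * ξ : ℝ) * Complex.I) * g (x - q) with hk
  have hki : Integrable k := by
    refine ((compSubConstCLM ℂ q g).integrable (μ := volume)).mono ?_ (.of_forall fun x => ?_)
    · have := g.continuous
      exact Continuous.aestronglyMeasurable (by fun_prop)
    · rw [hk, norm_mul, Complex.norm_exp_ofReal_mul_I, one_mul, compSubConstCLM_apply]
  have hFk : ∀ η, 𝓕 k η =
      Complex.exp ((-2 * Real.pi * q * (η + ξ) : ℝ) * Complex.I) * 𝓕 g (η + ξ) := by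
    intro η
    rw [Real.fourier_real_eq_integral_exp_smul, fourierS_apply, ← integral_const_mul,
      ← integral_add_right_eq_self _ q]
    refine integral_congr_ae (.of_forall fun x => ?_)
    simp only [hk, smul_eq_mul, add_sub_cancel_right, ← mul_assoc, ← Complex.exp_add]
    congr 2
    push_cast
    ring
  -- Write `f` as the Fourier transform of `𝓕⁻ f` and move that transform onto the modulated,
  -- translated window `k`.
  have h1 : stft f g q ξ = ∫ η, 𝓕⁻ f η * 𝓕 k η := by
    have h := VectorFourier.integral_fourierIntegral_smul_eq_flip (μ := volume) (ν := volume)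
      (L := innerₗ ℝ) Real.continuous_fourierChar continuous_inner
      (𝓕⁻ f).integrable hki
    have h' : ∫ x, 𝓕 (𝓕⁻ f) x * k x = ∫ η, 𝓕⁻ f η * 𝓕 k η := by
      rw [flip_innerₗ] at h
      exact h
    rw [← h', stft_apply]
    refine integral_congr_ae (.of_forall fun x => ?_)
    simp only [FourierTransform.fourier_fourierInv_eq, hk]
    ring
  rw [h1, ← integral_neg_eq_self, stft_apply]
  have h2 : ∀ η, 𝓕⁻ f (-η) * 𝓕 k (-η) =
      Complex.exp ((-2 * Real.pi * q * ξ : ℝ) * Complex.I) *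
      (Complex.exp ((-2 * Real.pi * η * -q : ℝ) * Complex.I) * (𝓕 f η * 𝓕 g (η - ξ))) := by
    intro η
    rw [hFk, fourierS_apply_neg, ← fourierS_even hg (η - ξ), ← mul_assoc, ← mul_assoc,
      ← mul_assoc, ← Complex.exp_add, show -(η - ξ) = -η + ξ by ring, mul_comm (𝓕 f η)]
    congr 3
    push_cast
    ring
  simp only [h2, integral_const_mul]
  rw [norm_mul, Complex.norm_exp_ofReal_mul_I, one_mul]

/-- Multiplication by a chirp shears the short-time Fourier transform. -/
theorem norm_stft_chirpS (a : ℝ) (f g : 𝓢(ℝ, ℂ)) (q ξ : ℝ) :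
    ‖stft (chirpS a f) (chirpS (-a) g) q (ξ + a / Real.pi * q)‖ = ‖stft f g q ξ‖ := by
  have hpi : (Real.pi : ℂ) ≠ 0 := by exact_mod_cast Real.pi_ne_zero
  have h : ∀ x : ℝ, Complex.exp ((-2 * Real.pi * x * (ξ + a / Real.pi * q) : ℝ) * Complex.I) *
      (chirpS a f x * chirpS (-a) g (x - q)) =
      Complex.exp ((-a * q ^ 2 : ℝ) * Complex.I) *
      (Complex.exp ((-2 * Real.pi * x * ξ : ℝ) * Complex.I) * (f x * g (x - q))) := by
    intro x
    rw [chirpS_apply, chirpS_apply, chirp, chirp]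
    have : Complex.exp ((-2 * Real.pi * x * (ξ + a / Real.pi * q) : ℝ) * Complex.I) *
        Complex.exp ((a * x ^ 2 : ℝ) * Complex.I) *
        Complex.exp ((-a * (x - q) ^ 2 : ℝ) * Complex.I) =
        Complex.exp ((-a * q ^ 2 : ℝ) * Complex.I) *
        Complex.exp ((-2 * Real.pi * x * ξ : ℝ) * Complex.I) := by
      rw [← Complex.exp_add, ← Complex.exp_add, ← Complex.exp_add]
      congr 1
      push_cast
      field_simp
      ring
    linear_combination (f x * g (x - q)) * this
  rw [stft_apply, stft_apply]
  simp only [h, integral_const_mul]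
  rw [norm_mul, Complex.norm_exp_ofReal_mul_I, one_mul]

/-! ### The joint distribution of noisy position and momentum -/

/-- The measure with density `|f|²`. -/
def sqMeasure (f : 𝓢(ℝ, ℂ)) : Measure ℝ := volume.withDensity fun x => ‖f x‖ₑ ^ 2

/-- The measure on phase space whose density is the squared modulus of the short-time Fourier
transform. -/
def phaseMeasure (f g : 𝓢(ℝ, ℂ)) : Measure (ℝ × ℝ) :=
  volume.withDensity fun z => ‖stft f g z.1 z.2‖ₑ ^ 2

theorem measurable_enorm_sq (f : 𝓢(ℝ, ℂ)) : Measurable fun x => ‖f x‖ₑ ^ 2 := by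
  have := f.continuous
  fun_prop

theorem measurable_enorm_sq_stft (f g : 𝓢(ℝ, ℂ)) :
    Measurable fun z : ℝ × ℝ => ‖stft f g z.1 z.2‖ₑ ^ 2 :=
  (measurable_stft f g).enorm.pow_const 2

theorem measurable_enorm_sq_stft_right (f g : 𝓢(ℝ, ℂ)) (q : ℝ) :
    Measurable fun ξ => ‖stft f g q ξ‖ₑ ^ 2 :=
  ((𝓕 (windowed f g q)).continuous.measurable.enorm).pow_const 2

instance (f : 𝓢(ℝ, ℂ)) : SFinite (sqMeasure f) := by unfold sqMeasure; infer_instance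

theorem lintegral_sqMeasure (f : 𝓢(ℝ, ℂ)) {F : ℝ → ℝ≥0∞} (hF : Measurable F) :
    ∫⁻ x, F x ∂(sqMeasure f) = ∫⁻ x, ‖f x‖ₑ ^ 2 * F x := by
  rw [sqMeasure, lintegral_withDensity_eq_lintegral_mul _ (measurable_enorm_sq f) hF]
  rfl

theorem lintegral_map_prod_sqMeasure (f g : 𝓢(ℝ, ℂ)) {F : ℝ → ℝ≥0∞} (hF : Measurable F) :
    ∫⁻ z, F z ∂(((sqMeasure f).prod (sqMeasure g)).map fun z => z.1 + z.2) =
      ∫⁻ x, ‖f x‖ₑ ^ 2 * ∫⁻ y, ‖g y‖ₑ ^ 2 * F (x + y) := by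
  have hF2 : Measurable fun z : ℝ × ℝ => F (z.1 + z.2) := hF.comp (by fun_prop)
  rw [lintegral_map hF (by fun_prop), lintegral_prod _ hF2.aemeasurable,
    lintegral_sqMeasure f hF2.lintegral_prod_right']
  congr! 3 with x
  exact lintegral_sqMeasure g (hF.comp (by fun_prop))

theorem lintegral_phaseMeasure (f g : 𝓢(ℝ, ℂ)) {F : ℝ × ℝ → ℝ≥0∞} (hF : Measurable F) :
    ∫⁻ z, F z ∂(phaseMeasure f g) = ∫⁻ q, ∫⁻ ξ, ‖stft f g q ξ‖ₑ ^ 2 * F (q, ξ) := by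
  have hm := measurable_enorm_sq_stft f g
  rw [phaseMeasure, lintegral_withDensity_eq_lintegral_mul _ hm hF, Measure.volume_eq_prod,
    lintegral_prod _ (hm.mul hF).aemeasurable]
  rfl

/-- Plancherel in `ξ` at fixed `q` leaves the integral of `|f x|² |g (x - q)|²` over `x`, which for
even `g` is the convolution of the two densities. -/
theorem map_fst_phaseMeasure (f : 𝓢(ℝ, ℂ)) {g : 𝓢(ℝ, ℂ)} (hg : ∀ x, g (-x) = g x) :
    (phaseMeasure f g).map Prod.fst =
      ((sqMeasure f).prod (sqMeasure g)).map fun z => z.1 + z.2 := by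
  refine Measure.ext_of_lintegral _ fun F hF => ?_
  have hf' : Measurable f := f.continuous.measurable
  have hg' : Measurable g := g.continuous.measurable
  have hF1 : Measurable fun z : ℝ × ℝ => F z.1 := hF.comp measurable_fst
  rw [lintegral_map_prod_sqMeasure f g hF, lintegral_map hF measurable_fst,
    lintegral_phaseMeasure f g hF1]
  have h1 : ∀ q, ∫⁻ ξ, ‖stft f g q ξ‖ₑ ^ 2 * F q =
      ∫⁻ x, ‖f x‖ₑ ^ 2 * (‖g (q - x)‖ₑ ^ 2 * F q) := by
    intro q
    have hm : Measurable fun ξ => ‖stft f g q ξ‖ₑ ^ 2 := measurable_enorm_sq_stft_right f g q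
    rw [lintegral_mul_const _ hm, lintegral_enorm_sq_stft, ← lintegral_mul_const _ (by fun_prop)]
    refine lintegral_congr fun x => ?_
    rw [← hg (x - q), neg_sub, mul_assoc]
  simp only [h1]
  rw [lintegral_lintegral_swap]
  · refine lintegral_congr fun x => ?_
    rw [lintegral_const_mul _ (by fun_prop), ← lintegral_add_left_eq_self _ x]
    simp
  · refine Measurable.aemeasurable ?_
    simp only [Function.uncurry_def]
    fun_prop

/-- The Fourier transform rotates phase space by a quarter turn, which reduces this to the position
marginal; the reflection `q ↦ -q` preserves Lebesgue measure. -/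
theorem map_snd_phaseMeasure (f : 𝓢(ℝ, ℂ)) {g : 𝓢(ℝ, ℂ)} (hg : ∀ x, g (-x) = g x) :
    (phaseMeasure f g).map Prod.snd =
      ((sqMeasure (𝓕 f)).prod (sqMeasure (𝓕 g))).map fun z => z.1 + z.2 := by
  rw [← map_fst_phaseMeasure _ (fourierS_even hg)]
  refine Measure.ext_of_lintegral _ fun F hF => ?_
  have hm := measurable_enorm_sq_stft f g
  have hF1 : Measurable fun z : ℝ × ℝ => F z.1 := hF.comp measurable_fst
  have hF2 : Measurable fun z : ℝ × ℝ => F z.2 := hF.comp measurable_snd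
  rw [lintegral_map hF measurable_snd, lintegral_map hF measurable_fst,
    lintegral_phaseMeasure _ _ hF2, lintegral_phaseMeasure _ _ hF1, lintegral_lintegral_swap]
  · refine lintegral_congr fun ξ => ?_
    have hm' : Measurable fun q => ‖stft (𝓕 f) (𝓕 g) ξ q‖ₑ ^ 2 * F ξ :=
      (measurable_enorm_sq_stft_right (𝓕 f) (𝓕 g) ξ).mul_const _
    refine Eq.trans ?_
      ((Measure.measurePreserving_neg (volume : Measure ℝ)).lintegral_comp hm')
    refine lintegral_congr fun q => ?_
    rw [← enorm_norm (stft f g q ξ), ← norm_stft_fourier f hg q ξ, enorm_norm]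
  · exact (hm.mul hF2).aemeasurable

theorem map_shear_phaseMeasure (a : ℝ) (f g : 𝓢(ℝ, ℂ)) :
    (phaseMeasure f g).map (fun z => z.2 + a / Real.pi * z.1) =
      (phaseMeasure (chirpS a f) (chirpS (-a) g)).map Prod.snd := by
  refine Measure.ext_of_lintegral _ fun F hF => ?_
  have hF2 : Measurable fun z : ℝ × ℝ => F (z.2 + a / Real.pi * z.1) := hF.comp (by fun_prop)
  have hF3 : Measurable fun z : ℝ × ℝ => F z.2 := hF.comp measurable_snd
  rw [lintegral_map hF measurable_snd, lintegral_map hF (by fun_prop),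
    lintegral_phaseMeasure _ _ hF2, lintegral_phaseMeasure _ _ hF3]
  refine lintegral_congr fun q => ?_
  rw [← lintegral_add_right_eq_self (fun ξ => ‖stft (chirpS a f) (chirpS (-a) g) q ξ‖ₑ ^ 2 *
    F ξ) (a / Real.pi * q)]
  refine lintegral_congr fun ξ => ?_
  rw [← enorm_norm (stft f g q ξ), ← norm_stft_chirpS a, enorm_norm]

theorem chirpS_even (a : ℝ) {g : 𝓢(ℝ, ℂ)} (hg : ∀ x, g (-x) = g x) (x : ℝ) :
    chirpS a g (-x) = chirpS a g x := by
  rw [chirpS_apply, chirpS_apply, hg, chirp, chirp, neg_sq]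

/-- The distribution of the noisy observable `Q(θ)`, up to scaling. -/
theorem map_shear_phaseMeasure_eq (a : ℝ) (f : 𝓢(ℝ, ℂ)) {g : 𝓢(ℝ, ℂ)}
    (hg : ∀ x, g (-x) = g x) :
    (phaseMeasure f g).map (fun z => z.2 + a / Real.pi * z.1) =
      ((sqMeasure (𝓕 (chirpS a f))).prod (sqMeasure (𝓕 (chirpS (-a) g)))).map
        fun z => z.1 + z.2 := by
  rw [map_shear_phaseMeasure, map_snd_phaseMeasure _ (chirpS_even _ hg)]

/-! ### Moments of the densities, and an uncertainty principle -/

theorem isProbabilityMeasure_sqMeasure {f : 𝓢(ℝ, ℂ)} (hf : ∫ x, ‖f x‖ ^ 2 = 1) :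
    IsProbabilityMeasure (sqMeasure f) := by
  constructor
  rw [sqMeasure, withDensity_apply _ .univ, Measure.restrict_univ, lintegral_enorm_sq, hf,
    ENNReal.ofReal_one]

theorem toReal_enorm_sq (z : ℂ) : (‖z‖ₑ ^ 2).toReal = ‖z‖ ^ 2 := by simp

theorem integral_sqMeasure (f : 𝓢(ℝ, ℂ)) (F : ℝ → ℝ) :
    ∫ x, F x ∂(sqMeasure f) = ∫ x, ‖f x‖ ^ 2 * F x := by
  rw [sqMeasure, integral_withDensity_eq_integral_toReal_smul (measurable_enorm_sq f)
    (.of_forall fun x => by simp)]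
  simp only [toReal_enorm_sq, smul_eq_mul]

theorem integrable_sqMeasure_iff (f : 𝓢(ℝ, ℂ)) (F : ℝ → ℝ) :
    Integrable F (sqMeasure f) ↔ Integrable fun x => ‖f x‖ ^ 2 * F x := by
  rw [sqMeasure, integrable_withDensity_iff_integrable_smul' (measurable_enorm_sq f)
    (.of_forall fun x => by simp)]
  simp only [toReal_enorm_sq, smul_eq_mul]

theorem measureReal_sqMeasure (f : 𝓢(ℝ, ℂ)) {s : Set ℝ} (hs : MeasurableSet s) :
    (sqMeasure f).real s = ∫ x in s, ‖f x‖ ^ 2 := by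
  rw [← integral_indicator_one hs, integral_sqMeasure, ← integral_indicator hs]
  refine integral_congr_ae (.of_forall fun x => ?_)
  by_cases hx : x ∈ s <;> simp [hx]

theorem integrable_pow_sqMeasure (f : 𝓢(ℝ, ℂ)) (k : ℕ) :
    Integrable (fun y => y ^ k) (sqMeasure f) := by
  rw [integrable_sqMeasure_iff]
  have h1 := (f.integrable_pow_mul volume k).mul_bdd (f := fun x => ‖x‖ ^ k * ‖f x‖)
    (g := fun x => ‖f x‖) (c := SchwartzMap.seminorm ℝ 0 0 f)
    f.continuous.norm.aestronglyMeasurable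
    (.of_forall fun x => by simpa using norm_le_seminorm ℝ f x)
  refine h1.mono (Continuous.aestronglyMeasurable ?_) (.of_forall fun x => ?_)
  · have := f.continuous
    fun_prop
  · simp only [norm_mul, norm_pow, norm_norm]
    exact le_of_eq (by ring)

theorem integral_id_sqMeasure {g : 𝓢(ℝ, ℂ)} (hg : ∀ x, g (-x) = g x) :
    ∫ y, y ∂(sqMeasure g) = 0 := by
  rw [integral_sqMeasure]
  have h : ∫ y, ‖g y‖ ^ 2 * y = -∫ y, ‖g y‖ ^ 2 * y := by
    conv_lhs => rw [← integral_neg_eq_self]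
    rw [← integral_neg]
    simp [hg]
  linarith

/-- A function and its Fourier transform cannot both be concentrated near the origin. -/
theorem measureReal_fourier_add_le {h : 𝓢(ℝ, ℂ)} (hh : ∫ x, ‖h x‖ ^ 2 = 1) :
    (sqMeasure (𝓕 h)).real (Set.Icc (-(1 / 16)) (1 / 16)) +
      2 * (sqMeasure h).real (Set.Icc (-(1 / 16)) (1 / 16)) ≤ 9 / 4 := by
  set I : Set ℝ := Set.Icc (-(1 / 16)) (1 / 16) with hI
  have hIm : MeasurableSet I := measurableSet_Icc
  -- Split `h = u + k` with `u` supported in `[-1/8, 1/8]` and `k` vanishing on `I`: `𝓕 u` is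
  -- uniformly small because `u` has small `L¹` norm, and `𝓕 k` is small in `L²` when `h` has little
  -- mass off `I`.
  let b : ContDiffBump (0 : ℝ) := ⟨1 / 16, 1 / 8, by norm_num, by norm_num⟩
  have hbt : (fun x : ℝ => ((b x : ℝ) : ℂ)).HasTemperateGrowth :=
    Function.Complex.hasTemperateGrowth_ofReal.comp
      (b.hasCompactSupport.hasTemperateGrowth b.contDiff)
  set u := smulLeftCLM ℂ (fun x : ℝ => ((b x : ℝ) : ℂ)) h with hu
  have hux : ∀ x, u x = b x * h x := fun x => by
    rw [hu, smulLeftCLM_apply_apply hbt, smul_eq_mul]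
  set k := h - u with hk
  have hkx : ∀ x, k x = (1 - b x) * h x := fun x => by
    rw [hk, sub_apply, hux]; ring
  have hu1 : ∀ ξ, ‖𝓕 u ξ‖ ≤ 1 / 2 := by
    intro ξ
    refine (norm_fourier_apply_le_toLp_one u ξ).trans ?_
    rw [norm_toLp_one]
    -- On the support, `‖h‖ ≤ 1 + ‖h‖ ^ 2 / 4`. Both terms integrate to `1 / 4`.
    have hle : ∀ x, ‖u x‖ ≤ (Set.Icc (-(1 / 8) : ℝ) (1 / 8)).indicator (fun _ => 1) x +
        1 / 4 * ‖h x‖ ^ 2 := by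
      intro x
      rw [hux, norm_mul, Complex.norm_real, Real.norm_of_nonneg b.nonneg]
      by_cases hx : x ∈ Set.Icc (-(1 / 8) : ℝ) (1 / 8)
      · rw [Set.indicator_of_mem hx]
        nlinarith [sq_nonneg (‖h x‖ - 2), b.le_one (x := x), norm_nonneg (h x),
          mul_le_of_le_one_left (norm_nonneg (h x)) (b.le_one (x := x))]
      · have : b x = 0 := b.zero_of_le_dist (by
          rw [Real.dist_0_eq_abs]
          by_contra! hlt
          exact hx (abs_le.1 hlt.le))
        rw [Set.indicator_of_notMem hx, this]
        have := sq_nonneg ‖h x‖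
        linarith
    have hi : Integrable ((Set.Icc (-(1 / 8) : ℝ) (1 / 8)).indicator (fun _ => (1 : ℝ))) :=
      (integrable_indicator_iff measurableSet_Icc).2 (integrableOn_const (by simp))
    refine (integral_mono u.integrable.norm (hi.add ((integrable_norm_sq h).const_mul _))
      hle).trans ?_
    simp only [Pi.add_apply]
    rw [integral_add hi ((integrable_norm_sq h).const_mul _), integral_const_mul, hh,
      integral_indicator_const _ measurableSet_Icc, Real.volume_real_Icc]
    norm_num
  have hkint : ∫ x, ‖k x‖ ^ 2 ≤ ∫ x in Iᶜ, ‖h x‖ ^ 2 := by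
    rw [← integral_indicator hIm.compl]
    refine integral_mono (integrable_norm_sq k) ((integrable_norm_sq h).indicator hIm.compl)
      fun x => ?_
    simp only [hkx, norm_mul, mul_pow]
    have hb : ‖(1 : ℂ) - b x‖ = 1 - b x := by
      rw [← Complex.ofReal_one, ← Complex.ofReal_sub, Complex.norm_real,
        Real.norm_of_nonneg (by linarith [b.le_one (x := x)])]
    rw [hb]
    by_cases hx : x ∈ I
    · have : b x = 1 := b.one_of_mem_closedBall (by
        rw [Metric.mem_closedBall, Real.dist_0_eq_abs]; exact abs_le.2 hx)
      simp [this, hx]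
    · rw [Set.indicator_of_mem (by simpa using hx)]
      refine mul_le_of_le_one_left (sq_nonneg _) ?_
      exact pow_le_one₀ (by linarith [b.le_one (x := x)]) (by linarith [b.nonneg (x := x)])
  have hsplit : (sqMeasure h).real I = 1 - ∫ x in Iᶜ, ‖h x‖ ^ 2 := by
    rw [measureReal_sqMeasure h hIm, ← hh, ← integral_add_compl hIm (integrable_norm_sq h)]
    ring
  have hF : ∀ ξ, ‖𝓕 h ξ‖ ^ 2 ≤ 1 / 2 + 2 * ‖𝓕 k ξ‖ ^ 2 := by
    intro ξ
    have e : 𝓕 h = 𝓕 u + 𝓕 k := by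
      rw [← FourierTransform.fourier_add, hk, add_sub_cancel]
    rw [e, add_apply]
    have h1 := norm_add_le (𝓕 u ξ) (𝓕 k ξ)
    have h2 := hu1 ξ
    have h3 := norm_nonneg (𝓕 u ξ)
    have h4 := norm_nonneg (𝓕 k ξ)
    have h5 := norm_nonneg (𝓕 u ξ + 𝓕 k ξ)
    nlinarith [sq_nonneg (‖𝓕 u ξ‖ - ‖𝓕 k ξ‖)]
  -- The constant `1 / 2` over `I`, of length `1 / 8`, contributes `1 / 16`.
  have hfin : (sqMeasure (𝓕 h)).real I ≤ 1 / 16 + 2 * ∫ x, ‖k x‖ ^ 2 := by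
    rw [measureReal_sqMeasure _ hIm, ← integral_norm_sq_fourier k]
    have hc : IntegrableOn (fun _ : ℝ => (1 / 2 : ℝ)) I := integrableOn_const (by simp [hI])
    have hk2 : Integrable fun ξ => 2 * ‖𝓕 k ξ‖ ^ 2 := (integrable_norm_sq (𝓕 k)).const_mul 2
    refine (setIntegral_mono (integrable_norm_sq (𝓕 h)).integrableOn
      (hc.add hk2.integrableOn) hF).trans ?_
    simp only [Pi.add_apply]
    rw [integral_add hc hk2.integrableOn, setIntegral_const, Real.volume_real_Icc,
      ← integral_const_mul]
    refine add_le_add (by norm_num) (setIntegral_le_integral hk2 (.of_forall fun x => ?_))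
    positivity
  linarith

/-! ### The distribution of `Q(θ)` -/

/-- The action of `diagU θ` on Schwartz functions. -/
def diagS (θ : ℝ) (ψ : 𝓢(ℝ, ℂ)) : 𝓢(ℝ, ℂ) :=
  if Real.sin θ = 0 then ψ else 𝓕 (chirpS (Real.cos θ / (2 * Real.sin θ)) ψ)

/-- The window whose squared modulus is the density of the noise that the short-time Fourier
transform with window `g` adds to `Q(θ)`. -/
def noiseS (θ : ℝ) (g : 𝓢(ℝ, ℂ)) : 𝓢(ℝ, ℂ) :=
  if Real.sin θ = 0 then g else 𝓕 (chirpS (-(Real.cos θ / (2 * Real.sin θ))) g)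

theorem diagU_incl (θ : ℝ) (ψ : 𝓢(ℝ, ℂ)) : diagU θ (incl ψ) = incl (diagS θ ψ) := by
  by_cases hθ : Real.sin θ = 0
  · simp [diagU, diagS, hθ]
  · set a := Real.cos θ / (2 * Real.sin θ) with ha
    have h : mulUnitary (chirp a) (measurable_chirp a) (norm_chirp a) (incl ψ) =
        incl (chirpS a ψ) := by
      apply Lp.ext
      filter_upwards [coeFn_mulUnitary (chirp a) (measurable_chirp a) (norm_chirp a) (incl ψ),
        coeFn_incl ψ, coeFn_incl (chirpS a ψ)] with q h1 h2 h3
      rw [h1, h2, h3, chirpS_apply]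
    simp only [diagU, diagS, hθ, if_false, LinearIsometryEquiv.trans_apply, ← ha, h]
    exact toLp_fourier_eq (chirpS a ψ)

theorem norm_chirpS_apply (a : ℝ) (ψ : 𝓢(ℝ, ℂ)) (x : ℝ) : ‖chirpS a ψ x‖ = ‖ψ x‖ := by
  rw [chirpS_apply, norm_mul, norm_chirp, one_mul]

theorem integral_norm_sq_diagS (θ : ℝ) (ψ : 𝓢(ℝ, ℂ)) :
    ∫ x, ‖diagS θ ψ x‖ ^ 2 = ∫ x, ‖ψ x‖ ^ 2 := by
  unfold diagS
  split_ifs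
  · rfl
  · simp only [integral_norm_sq_fourier, norm_chirpS_apply]

theorem integral_norm_sq_noiseS (θ : ℝ) (ψ : 𝓢(ℝ, ℂ)) :
    ∫ x, ‖noiseS θ ψ x‖ ^ 2 = ∫ x, ‖ψ x‖ ^ 2 := by
  unfold noiseS
  split_ifs
  · rfl
  · simp only [integral_norm_sq_fourier, norm_chirpS_apply]

theorem noiseS_even (θ : ℝ) {g : 𝓢(ℝ, ℂ)} (hg : ∀ x, g (-x) = g x) (x : ℝ) :
    noiseS θ g (-x) = noiseS θ g x := by
  unfold noiseS
  split_ifs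
  · exact hg x
  · exact fourierS_even (chirpS_even _ hg) x

/-- With `2πξ` as momentum, this is the classical linear form in direction `θ`. If `sin θ ≠ 0`, it
is `2π sin θ` times the sheared frequency `ξ + (a / π) q` with `a = cos θ / (2 sin θ)`, and the
chirp turns the shear into a momentum marginal. -/
theorem map_phaseMeasure (θ r : ℝ) (f : 𝓢(ℝ, ℂ)) {g : 𝓢(ℝ, ℂ)} (hg : ∀ x, g (-x) = g x) :
    (phaseMeasure f g).map
        (fun z => r * (z.1 * Real.cos θ + 2 * Real.pi * z.2 * Real.sin θ)) =
      ((sqMeasure (diagS θ f)).prod (sqMeasure (noiseS θ g))).map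
        fun z => r * diagScale θ * (z.1 + z.2) := by
  have hmul : Measurable fun x : ℝ => r * diagScale θ * x := by fun_prop
  have hadd : Measurable fun z : ℝ × ℝ => z.1 + z.2 := by fun_prop
  by_cases hθ : Real.sin θ = 0
  · have h := congrArg (Measure.map fun x : ℝ => r * diagScale θ * x) (map_fst_phaseMeasure f hg)
    rw [Measure.map_map hmul measurable_fst, Measure.map_map hmul hadd] at h
    simp only [diagS, noiseS, hθ, if_true]
    refine Eq.trans (congrArg (fun X => (phaseMeasure f g).map X) ?_) h
    funext z
    simp only [diagScale, hθ, if_true, Function.comp_apply]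
    ring
  · have h := congrArg (Measure.map fun x : ℝ => r * diagScale θ * x)
      (map_shear_phaseMeasure_eq (Real.cos θ / (2 * Real.sin θ)) f hg)
    rw [Measure.map_map hmul (by fun_prop), Measure.map_map hmul hadd] at h
    simp only [diagS, noiseS, hθ, if_false]
    refine Eq.trans (congrArg (fun X => (phaseMeasure f g).map X) ?_) h
    funext z
    have := Real.pi_ne_zero
    simp only [diagScale, hθ, if_false, Function.comp_apply]
    field_simp
    ring

theorem isProbabilityMeasure_phaseMeasure {f g : 𝓢(ℝ, ℂ)} (hf : ∫ x, ‖f x‖ ^ 2 = 1)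
    (hg1 : ∫ x, ‖g x‖ ^ 2 = 1) (hg : ∀ x, g (-x) = g x) :
    IsProbabilityMeasure (phaseMeasure f g) := by
  have := isProbabilityMeasure_sqMeasure hf
  have := isProbabilityMeasure_sqMeasure hg1
  have h : IsProbabilityMeasure ((phaseMeasure f g).map Prod.fst) := by
    rw [map_fst_phaseMeasure f hg]
    exact Measure.isProbabilityMeasure_map (by fun_prop)
  constructor
  have h' := h.measure_univ
  rwa [Measure.map_apply measurable_fst .univ, Set.preimage_univ] at h'

theorem exists_even_window : ∃ g : 𝓢(ℝ, ℂ), (∀ x, g (-x) = g x) ∧ ∫ x, ‖g x‖ ^ 2 = 1 := by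
  let b : ContDiffBump (0 : ℝ) := ⟨1, 2, by norm_num, by norm_num⟩
  have hc : HasCompactSupport fun x : ℝ => ((b x : ℝ) : ℂ) :=
    b.hasCompactSupport.comp_left (g := Complex.ofReal) Complex.ofReal_zero
  have hd : ContDiff ℝ ∞ fun x : ℝ => ((b x : ℝ) : ℂ) :=
    Complex.ofRealCLM.contDiff.comp b.contDiff
  let u : 𝓢(ℝ, ℂ) := hc.toSchwartzMap hd
  have hu : ∀ x, u x = b x := fun x => rfl
  set N := ∫ x, ‖u x‖ ^ 2 with hN
  have hpos : 0 < N := by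
    refine integral_pos_of_integrable_nonneg_nonzero (x := 0) (u.continuous.norm.pow 2)
      (integrable_norm_sq u) (fun x => by positivity) ?_
    have : b 0 = 1 := b.one_of_mem_closedBall (by simp [b])
    simp [hu, this]
  refine ⟨((Real.sqrt N)⁻¹ : ℂ) • u, fun x => ?_, ?_⟩
  · simp [hu, b.neg]
  · have : ∀ x, ‖(((Real.sqrt N)⁻¹ : ℂ) • u) x‖ ^ 2 = N⁻¹ * ‖u x‖ ^ 2 := fun x => by
      rw [smul_apply, norm_smul, mul_pow, norm_inv, Complex.norm_real, inv_pow,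
        Real.norm_of_nonneg (Real.sqrt_nonneg _), Real.sq_sqrt hpos.le]
    simp only [this, integral_const_mul]
    rw [← hN, inv_mul_cancel₀ hpos.ne']

theorem diagScale_ne_zero (θ : ℝ) : diagScale θ ≠ 0 := by
  unfold diagScale
  split_ifs with h
  · intro h'
    have := Real.sin_sq_add_cos_sq θ
    rw [h, h'] at this
    norm_num at this
  · exact mul_ne_zero (by positivity) h

/-- Outside `[-1/16, 1/16]`, the variable `κ x` is nonpositive or exceeds `|κ| / 16`. -/
theorem one_sub_measureReal_Icc_le {μ : Measure ℝ} [IsProbabilityMeasure μ] {κ τ : ℝ}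
    (hτ : 16 * τ ≤ |κ|) :
    1 - μ.real (Set.Icc (-(1 / 16)) (1 / 16)) ≤
      μ.real {x | τ < κ * x} + μ.real {x | κ * x ≤ 0} := by
  rw [← probReal_compl_eq_one_sub measurableSet_Icc]
  refine le_trans (measureReal_mono ?_) (measureReal_union_le _ _)
  intro x hx
  by_contra hcon
  simp only [Set.mem_union, Set.mem_ofPred_eq, not_or, not_lt, not_le] at hcon
  apply hx
  rw [Set.mem_Icc, ← abs_le]
  have h1 : |κ| * |x| ≤ τ := by rw [← abs_mul, abs_of_pos hcon.2]; exact hcon.1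
  have h2 : 0 < |κ| := by
    rw [abs_pos]; rintro rfl; simp at hcon
  nlinarith

/-- For every state, the observables `Q(θ i)`, whose directions are positively dependent, are not
all positive with probability close to one, nor all negative (`σ = -1`). -/
theorem exists_le_sum_measureReal {θ w : Fin 3 → ℝ} (hw : ∀ i, 0 < w i)
    (hcos : ∑ i, w i * Real.cos (θ i) = 0) (hsin : ∑ i, w i * Real.sin (θ i) = 0)
    (h0 : Real.sin (θ 0) = 0) (h1 : Real.sin (θ 1) ≠ 0) :
    ∃ δ > 0, ∀ σ : ℝ, |σ| = 1 → ∀ f : 𝓢(ℝ, ℂ), ∫ x, ‖f x‖ ^ 2 = 1 →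
      δ ≤ ∑ i, (sqMeasure (diagS (θ i) f)).real {x | σ * (diagScale (θ i) * x) ≤ 0} := by
  obtain ⟨g, hge, hg1⟩ := exists_even_window
  set C := ∑ i, (w i * diagScale (θ i)) ^ 2 * ∫ y, y ^ 2 ∂(sqMeasure (noiseS (θ i) g)) with hC
  have hC0 : 0 ≤ C := Finset.sum_nonneg fun i _ =>
    mul_nonneg (sq_nonneg _) (integral_nonneg fun y => sq_nonneg y)
  have hκ : ∀ i, 0 < |w i * diagScale (θ i)| := fun i =>
    abs_pos.2 (mul_ne_zero (hw i).ne' (diagScale_ne_zero _))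
  -- Only the first two directions enter the uncertainty principle: leaving `[-1/16, 1/16]` there
  -- makes the scaled signal at least `τ` in size.
  set τ := min |w 0 * diagScale (θ 0)| |w 1 * diagScale (θ 1)| / 16 with hτd
  have hτ : 0 < τ := div_pos (lt_min (hκ 0) (hκ 1)) (by norm_num)
  -- Large enough for `2 * τ ≤ L` and for the noise term `C / (2 * L)` to be at most `τ / 8`.
  set L := 2 * τ + 4 * C / τ with hLd
  have hCτ : 0 ≤ 4 * C / τ := by positivity
  have hL : 0 < L := by linarith
  refine ⟨τ / 4 / (3 * L + τ), by positivity, fun σ hσ f hf => ?_⟩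
  have hσ2 : σ ^ 2 = 1 := by rw [← sq_abs, hσ, one_pow]
  have hpf : ∀ i, IsProbabilityMeasure (sqMeasure (diagS (θ i) f)) := fun i =>
    isProbabilityMeasure_sqMeasure ((integral_norm_sq_diagS _ f).trans hf)
  have hpg : ∀ i, IsProbabilityMeasure (sqMeasure (noiseS (θ i) g)) := fun i =>
    isProbabilityMeasure_sqMeasure ((integral_norm_sq_noiseS _ g).trans hg1)
  have hpm := isProbabilityMeasure_phaseMeasure hf hg1 hge
  have key := sum_measureReal_le (m := phaseMeasure f g)
    (X := fun i z => σ * w i * (z.1 * Real.cos (θ i) + 2 * Real.pi * z.2 * Real.sin (θ i)))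
    (μ := fun i => sqMeasure (diagS (θ i) f)) (γ := fun i => sqMeasure (noiseS (θ i) g))
    (κ := fun i => σ * w i * diagScale (θ i)) (fun i => by fun_prop)
    (fun z => by
      rw [Fin.sum_univ_three] at hcos hsin
      linear_combination σ * z.1 * hcos + σ * (2 * Real.pi * z.2) * hsin)
    (fun i => map_phaseMeasure (θ i) (σ * w i) f hge)
    (fun i => by simpa using integrable_pow_sqMeasure (noiseS (θ i) g) 1)
    (fun i => integrable_pow_sqMeasure (noiseS (θ i) g) 2)
    (fun i => integral_id_sqMeasure (noiseS_even (θ i) hge)) (L := L) (τ := τ) hL hτ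
    (by linarith)
  have eC : ∑ i, (σ * w i * diagScale (θ i)) ^ 2 *
      ∫ y, y ^ 2 ∂(sqMeasure (noiseS (θ i) g)) = C := by
    rw [hC]
    refine Finset.sum_congr rfl fun i _ => ?_
    rw [mul_assoc σ, mul_pow σ, hσ2, one_mul]
  have eB : ∀ i, {x : ℝ | σ * w i * diagScale (θ i) * x ≤ 0} =
      {x | σ * (diagScale (θ i) * x) ≤ 0} := by
    intro i
    ext x
    simp only [Set.mem_ofPred_eq]
    rw [show σ * w i * diagScale (θ i) * x = w i * (σ * (diagScale (θ i) * x)) by ring]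
    exact ⟨fun h => nonpos_of_mul_nonpos_right h (hw i),
      fun h => mul_nonpos_of_nonneg_of_nonpos (hw i).le h⟩
  rw [eC] at key
  -- The chirp does not change the modulus, so the chirped `f` still has the density of direction `θ
  -- 0`, while its Fourier transform is `diagS (θ 1) f`.
  have hunc := measureReal_fourier_add_le
    (h := chirpS (Real.cos (θ 1) / (2 * Real.sin (θ 1))) f)
    (by simpa only [norm_chirpS_apply] using hf)
  have e0 : sqMeasure (chirpS (Real.cos (θ 1) / (2 * Real.sin (θ 1))) f) =
      sqMeasure (diagS (θ 0) f) := by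
    simp only [sqMeasure, diagS, h0, if_true]
    congr 1
    funext x
    rw [← enorm_norm, norm_chirpS_apply, enorm_norm]
  have e1 : 𝓕 (chirpS (Real.cos (θ 1) / (2 * Real.sin (θ 1))) f) = diagS (θ 1) f := by
    simp only [diagS, h1, if_false]
  rw [e0, e1] at hunc
  have hτ0 : 16 * τ ≤ |σ * w 0 * diagScale (θ 0)| := by
    rw [mul_assoc, abs_mul, hσ, one_mul, hτd]
    linarith [min_le_left |w 0 * diagScale (θ 0)| |w 1 * diagScale (θ 1)|]
  have hτ1 : 16 * τ ≤ |σ * w 1 * diagScale (θ 1)| := by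
    rw [mul_assoc, abs_mul, hσ, one_mul, hτd]
    linarith [min_le_right |w 0 * diagScale (θ 0)| |w 1 * diagScale (θ 1)|]
  have k0 := one_sub_measureReal_Icc_le (μ := sqMeasure (diagS (θ 0) f)) hτ0
  have k1 := one_sub_measureReal_Icc_le (μ := sqMeasure (diagS (θ 1) f)) hτ1
  have hCL : C / (2 * L) ≤ τ / 8 := by
    rw [div_le_iff₀ (by positivity)]
    have : τ * (4 * C / τ) = 4 * C := by field_simp
    nlinarith [sq_nonneg τ]
  simp only [Fin.sum_univ_three, eB] at key k0 k1 ⊢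
  rw [div_le_iff₀ (by positivity)]
  have a2 : 0 ≤ (sqMeasure (diagS (θ 2) f)).real {x | τ < σ * w 2 * diagScale (θ 2) * x} :=
    measureReal_nonneg
  have a1 : 0 ≤ (sqMeasure (diagS (θ 1) f)).real {x | τ < σ * w 1 * diagScale (θ 1) * x} :=
    measureReal_nonneg
  have b2 : 0 ≤ (sqMeasure (diagS (θ 2) f)).real {x | σ * (diagScale (θ 2) * x) ≤ 0} :=
    measureReal_nonneg
  have b1 : 0 ≤ (sqMeasure (diagS (θ 1) f)).real {x | σ * (diagScale (θ 1) * x) ≤ 0} :=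
    measureReal_nonneg
  set A0 := (sqMeasure (diagS (θ 0) f)).real {x | τ < σ * w 0 * diagScale (θ 0) * x}
  set A1 := (sqMeasure (diagS (θ 1) f)).real {x | τ < σ * w 1 * diagScale (θ 1) * x}
  set A2 := (sqMeasure (diagS (θ 2) f)).real {x | τ < σ * w 2 * diagScale (θ 2) * x}
  set B0 := (sqMeasure (diagS (θ 0) f)).real {x | σ * (diagScale (θ 0) * x) ≤ 0}
  set B1 := (sqMeasure (diagS (θ 1) f)).real {x | σ * (diagScale (θ 1) * x) ≤ 0}
  set B2 := (sqMeasure (diagS (θ 2) f)).real {x | σ * (diagScale (θ 2) * x) ≤ 0}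
  -- The uncertainty bound gives `2 (A0 + B0) + (A1 + B1) ≥ 3 - 9/4`; halve it. Against the noise
  -- term `τ / 8`, a margin of `τ / 4` remains, the numerator of `δ`.
  have hA : 3 / 8 - (B0 + B1 + B2) ≤ A0 + A1 + A2 := by linarith
  have := mul_le_mul_of_nonneg_left hA hτ.le
  nlinarith

/-! ### The operators `sgn Q(θ)` -/

theorem coeFn_mul_diagU (θ : ℝ) (x : L2) :
    diagU θ (sgnQ θ x) =ᵐ[volume] fun a => (Real.sign (diagScale θ * a) : ℂ) * diagU θ x a := by
  have h : diagU θ (sgnQ θ x) = mulLp (fun a : ℝ => (Real.sign (diagScale θ * a) : ℂ))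
      (memLp_top (Complex.measurable_ofReal.comp
        (measurable_sign.comp (diagQ θ).measurable_h)) (C := 1)
        fun a => by simpa using abs_sign_le_one (diagScale θ * a)) (diagU θ x) :=
    (diagU θ).apply_symm_apply _
  rw [h]
  exact coeFn_mulLp _ _ _

theorem isSymmetric_sgnQ (θ : ℝ) : (sgnQ θ).IsSymmetric := by
  intro x y
  change inner ℂ (sgnQ θ x) y = inner ℂ x (sgnQ θ y)
  rw [← (diagU θ).inner_map_map, ← (diagU θ).inner_map_map x, L2.inner_def, L2.inner_def]
  refine integral_congr_ae ?_
  filter_upwards [coeFn_mul_diagU θ x, coeFn_mul_diagU θ y] with a h1 h2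
  rw [h1, h2]
  simp only [RCLike.inner_apply, map_mul, Complex.conj_ofReal]
  ring

theorem re_inner_sgnQ (θ : ℝ) (ψ : 𝓢(ℝ, ℂ)) :
    (inner ℂ (sgnQ θ (incl ψ)) (incl ψ)).re =
      ∫ x, Real.sign (diagScale θ * x) ∂(sqMeasure (diagS θ ψ)) := by
  rw [← (diagU θ).inner_map_map, L2.inner_def, integral_sqMeasure, ← Complex.ofReal_re
    (∫ x, ‖diagS θ ψ x‖ ^ 2 * Real.sign (diagScale θ * x)), ← integral_complex_ofReal]
  congr 1
  refine integral_congr_ae ?_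
  have h2 := coeFn_incl (diagS θ ψ)
  rw [← diagU_incl] at h2
  filter_upwards [coeFn_mul_diagU θ (incl ψ), h2] with a h1 h2
  rw [h1, h2]
  simp only [RCLike.inner_apply, map_mul, Complex.conj_ofReal]
  rw [mul_left_comm, Complex.mul_conj, Complex.normSq_eq_norm_sq]
  push_cast
  ring

/-- Pointwise, `σ * sign` is at most one, and at most zero where `σ * (c * x) ≤ 0`. -/
theorem integral_sign_le {μ : Measure ℝ} [IsProbabilityMeasure μ] {σ c : ℝ} (hσ : |σ| = 1) :
    σ * ∫ x, Real.sign (c * x) ∂μ ≤ 1 - μ.real {x | σ * (c * x) ≤ 0} := by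
  have hB : MeasurableSet {x : ℝ | σ * (c * x) ≤ 0} :=
    measurableSet_le (by fun_prop) (by fun_prop)
  have hi : Integrable (fun x => Real.sign (c * x)) μ :=
    Integrable.of_bound (measurable_sign.comp (by fun_prop)).aestronglyMeasurable 1
      (.of_forall fun x => abs_sign_le_one _)
  have hi1 : Integrable ({x : ℝ | σ * (c * x) ≤ 0}.indicator (1 : ℝ → ℝ)) μ :=
    (integrable_const (1 : ℝ)).indicator hB
  have e : ∫ x, 1 - {x : ℝ | σ * (c * x) ≤ 0}.indicator (1 : ℝ → ℝ) x ∂μ =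
      1 - μ.real {x | σ * (c * x) ≤ 0} := by
    rw [integral_sub (integrable_const _) hi1, integral_indicator_one hB]
    simp
  rw [← integral_const_mul, ← e]
  refine integral_mono (hi.const_mul σ) ((integrable_const _).sub hi1) fun x => ?_
  have h1 : σ * Real.sign (c * x) ≤ 1 := by
    refine (le_abs_self _).trans ?_
    rw [abs_mul, hσ, one_mul]
    exact abs_sign_le_one _
  by_cases hx : σ * (c * x) ≤ 0
  · simp only [Set.indicator_of_mem (show x ∈ {x : ℝ | σ * (c * x) ≤ 0} from hx), Pi.one_apply,
      sub_self]
    rcases lt_trichotomy (c * x) 0 with h | h | h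
    · rw [Real.sign_of_neg h]
      nlinarith
    · rw [h, Real.sign_zero, mul_zero]
    · rw [Real.sign_of_pos h]
      nlinarith
  · simpa only [Set.indicator_of_notMem (show x ∉ {x : ℝ | σ * (c * x) ≤ 0} from hx), Pi.one_apply,
      sub_zero] using h1

theorem norm_incl_sq (ψ : 𝓢(ℝ, ℂ)) : ‖incl ψ‖ ^ 2 = ∫ x, ‖ψ x‖ ^ 2 := by
  rw [← Complex.ofReal_inj, Complex.ofReal_pow, ← integral_complex_ofReal]
  rw [← Complex.coe_algebraMap, ← inner_self_eq_norm_sq_to_K (𝕜 := ℂ), L2.inner_def]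
  refine integral_congr_ae ?_
  filter_upwards [coeFn_incl ψ] with x hx
  rw [hx, inner_self_eq_norm_sq_to_K]
  simp

/-- A bound on the quadratic form of a symmetric operator at the unit vectors of a dense subspace
bounds its norm. -/
theorem norm_le_of_abs_re_inner_incl_le {A : L2 →L[ℂ] L2} (hA : A.IsSymmetric) {M : ℝ}
    (hM : 0 ≤ M)
    (h : ∀ f : 𝓢(ℝ, ℂ), ∫ x, ‖f x‖ ^ 2 = 1 → |(inner ℂ (A (incl f)) (incl f)).re| ≤ M) :
    ‖A‖ ≤ M := by
  have hS : ∀ f : 𝓢(ℝ, ℂ), |(inner ℂ (A (incl f)) (incl f)).re| ≤ M * ‖incl f‖ ^ 2 := by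
    intro f
    by_cases hf : ‖incl f‖ = 0
    · rw [norm_eq_zero] at hf
      simp [hf]
    · set r := ‖incl f‖ with hr
      have hr0 : 0 < r := lt_of_le_of_ne (norm_nonneg _) (Ne.symm hf)
      have h1 := h (((r⁻¹ : ℝ) : ℂ) • f) (by
        rw [← norm_incl_sq, map_smul, norm_smul, ← hr, Complex.norm_real,
          Real.norm_of_nonneg (by positivity), inv_mul_cancel₀ hf, one_pow])
      rw [map_smul, map_smul, inner_smul_left, inner_smul_right, Complex.conj_ofReal,
        Complex.re_ofReal_mul, Complex.re_ofReal_mul, ← mul_assoc, abs_mul,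
        abs_of_nonneg (by positivity)] at h1
      have : r⁻¹ * r⁻¹ = (r ^ 2)⁻¹ := by rw [sq, mul_inv]
      rwa [this, inv_mul_le_iff₀ (by positivity), mul_comm] at h1
  have hall : ∀ x : L2, |(inner ℂ (A x) x).re| ≤ M * ‖x‖ ^ 2 := by
    intro x
    refine denseRange_incl.induction_on x (isClosed_le ?_ ?_) hS
    · exact (Complex.continuous_re.comp (A.continuous.inner continuous_id)).abs
    · fun_prop
  rw [ContinuousLinearMap.norm_eq_iSup_rayleighQuotient A hA]
  refine ciSup_le fun x => ?_
  rw [abs_div, abs_sq]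
  exact div_le_of_le_mul₀ (sq_nonneg _) hM (hall x)

/-- If the directions `θ i` are positively dependent then the norm of the sum of the three operators
`sgn Q(θ i)` is less than three. -/
theorem norm_sum_sgnQ_lt {θ w : Fin 3 → ℝ} (hw : ∀ i, 0 < w i)
    (hcos : ∑ i, w i * Real.cos (θ i) = 0) (hsin : ∑ i, w i * Real.sin (θ i) = 0)
    (h0 : Real.sin (θ 0) = 0) (h1 : Real.sin (θ 1) ≠ 0) :
    ‖∑ i, sgnQ (θ i)‖ < 3 := by
  obtain ⟨δ, hδ, H⟩ := exists_le_sum_measureReal hw hcos hsin h0 h1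
  have hsym : (∑ i, sgnQ (θ i)).IsSymmetric := by
    intro x y
    simp only [Fin.sum_univ_three]
    have e := fun i => isSymmetric_sgnQ (θ i) x y
    simp only [ContinuousLinearMap.coe_coe] at e
    simp [inner_add_left, inner_add_right, e]
  have hbound : ∀ σ : ℝ, |σ| = 1 → ∀ f : 𝓢(ℝ, ℂ), ∫ x, ‖f x‖ ^ 2 = 1 →
      σ * (inner ℂ ((∑ i, sgnQ (θ i)) (incl f)) (incl f)).re ≤ 3 - δ := by
    intro σ hσ f hf
    have hp : ∀ i, IsProbabilityMeasure (sqMeasure (diagS (θ i) f)) := fun i =>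
      isProbabilityMeasure_sqMeasure ((integral_norm_sq_diagS _ f).trans hf)
    rw [sum_apply, sum_inner, Complex.re_sum, Finset.mul_sum]
    simp only [re_inner_sgnQ]
    refine (Finset.sum_le_sum fun i _ => integral_sign_le hσ).trans ?_
    rw [Finset.sum_sub_distrib]
    have := H σ hσ f hf
    simp only [Finset.sum_const, Finset.card_univ, Fintype.card_fin, nsmul_eq_mul]
    norm_num
    linarith
  -- The maximum with zero supplies the nonnegative bound required below without an upper estimate
  -- for `δ`.
  have hle : ‖∑ i, sgnQ (θ i)‖ ≤ max (3 - δ) 0 := by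
    refine norm_le_of_abs_re_inner_incl_le hsym (le_max_right _ _) fun f hf => ?_
    refine le_trans (abs_le'.2 ⟨?_, ?_⟩) (le_max_left _ _)
    · simpa using hbound 1 (by simp) f hf
    · simpa using hbound (-1) (by simp) f hf
  exact hle.trans_lt (max_lt (by linarith) (by norm_num))

end PhaseSpace

end

theorem lemma3p1 (s t : ℝ) (hs : s < Real.pi) (ht : Real.pi < t) (hst : t < s + Real.pi) :
    ‖PhaseSpace.sgnQ 0 + PhaseSpace.sgnQ s + PhaseSpace.sgnQ t‖ < 3 := by
  have h1 : 0 < Real.sin s := Real.sin_pos_of_pos_of_lt_pi (by linarith) hs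
  have h2 : 0 < -Real.sin t := by
    rw [← Real.sin_sub_pi]
    exact Real.sin_pos_of_pos_of_lt_pi (by linarith) (by linarith)
  have h3 : 0 < Real.sin (t - s) := Real.sin_pos_of_pos_of_lt_pi (by linarith) (by linarith)
  have h := PhaseSpace.norm_sum_sgnQ_lt (θ := ![0, s, t])
    -- Each weight is the sine of the angle between the other two directions; all three are positive
    -- precisely because `0`, `s`, `t` lie in no closed half-plane.
    (w := ![Real.sin (t - s), -Real.sin t, Real.sin s])
    (by intro i; fin_cases i; exacts [h3, h2, h1])
    (by simp [Fin.sum_univ_three, Real.sin_sub]; ring)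
    (by simp [Fin.sum_univ_three]; ring)
    (by simp) (by simpa using h1.ne')
  simpa [Fin.sum_univ_three] using h
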